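/- Fix $k$ and a symmetric $B\in[0,1]^{k\times k}$. Let $[n]$ be partitioned into clusters $C_1,\dots,C_k$ of sizes $n_r=|C_r|\ge 2$, and let $G$ be a random graph on $[n]$ from the stochastic blockmodel: the pairs $\{i,j\}$ appear as edges independently, with probability $B_{r,s}$ if $i\in C_r$, $j\in C_s$. For $1\le r\le s\le k$ let $C_{(r,s)}$ be the set of pairs $\{i,j\}$, $i\ne j$, with $i\in C_r$, $j\in C_s$; let $m_{r,s}=|C_{(r,s)}|$ and let $\widehat m_{r,s}$ be the number of edges of $G$ in $C_{(r,s)}$. Let $A(L(K_n))$ be the adjacency matrix of the line graph of the complete graph $K_n$ (indexed by all pairs, with entry $1$ when the two pairs share exactly one vertex and $0$ otherwise). Let $Q$ be the $\binom n2\times\binom{k+1}2$ matrix with $Q_{e,(r,s)}=m_{r,s}^{-1/2}$ if $e\in C_{(r,s)}$ and $0$ otherwise, let $P=\mathrm{diag}(\delta_e)$ with $\delta_e$ the indicator that $e$ is an edge of $G$, and let $\overline{\hat Q}=PQ\,\mathrm{diag}\big(\sqrt{m_{r,s}/\widehat m_{r,s}}\big)$, where the factor is replaced by $1$ if $\widehat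 m_{r,s}=0$. For $e\in C_{(r,s)}$ put $Y_e=\delta_e\sqrt{m_{r,s}/\widehat m_{r,s}}$ (same convention). The mean $\mathbb E[Y_e]$ is the same for all $e\in C_{(r,s)}$; call it $\mu_{r,s}$. Let $$H=A(L(K_n))\big(\overline{\hat Q}-Q\,\mathrm{diag}(\mu_{r,s})\big).$$ Then the columns of $H$ are independent random vectors. Moreover, when all cluster sizes are proportional to $n$, $\|H\|_F\le Cn^{3/4}$ with probability $1-O(1/n)$; precisely: for every $c>0$ there are constants $C,K,N$, depending only on $k$, $B$ and $c$, such that for all $n\ge N$, all partitions of $[n]$ as above with $n_r\ge cn$ for every $r$, and all $G$ as above, $$\mathbb P\big[\|H\|_F\le Cn^{3/4}\big]\ge 1-\frac Kn .$$ -/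

import Mathlib

universe u

open MeasureTheory ProbabilityTheory
open scoped Matrix.Norms.Frobenius

noncomputable section

namespace SBMLineGraph

/-- The 2-subsets `{i,j}` of the vertex set, i.e. the edges of the complete graph `K_n`. -/
abbrev Edge (n : ℕ) : Type := (⊤ : SimpleGraph (Fin n)).edgeSet

/-- The indices `(r,s)` with `r ≤ s` of the blocks of the induced edge partition. -/
abbrev Block (k : ℕ) : Type := {p : Fin k × Fin k // p.1 ≤ p.2}

/-- `A(L(K_n))`, the adjacency matrix of the line graph of the complete graph. -/
def lineAdj (n : ℕ) : Matrix (Edge n) (Edge n) ℝ :=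
  open Classical in (⊤ : SimpleGraph (Fin n)).lineGraph.adjMatrix ℝ

variable {n k : ℕ}

/-- `n_r = |C_r|`, where `C_r = {i | z i = r}` and `z` assigns to each vertex its cluster. -/
def clusterSize (z : Fin n → Fin k) (r : Fin k) : ℕ :=
  (Finset.univ.filter fun i => z i = r).card

/-- The index `(r,s)`, `r ≤ s`, of the block of the induced partition that contains the edge `e`:
the two cluster labels of the endpoints of `e`, in increasing order. -/
def blockOf (z : Fin n → Fin k) (e : Edge n) : Block k :=
  Sym2.sortEquiv ((e : Sym2 (Fin n)).map z)

/-- `{i,j}` lies in `C_{(r,s)}` iff one endpoint lies in `C_r` and the other one in `C_s`. -/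
theorem blockOf_eq_iff (z : Fin n → Fin k) (i j : Fin n)
    (h : s(i, j) ∈ (⊤ : SimpleGraph (Fin n)).edgeSet) (p : Block k) :
    blockOf z ⟨s(i, j), h⟩ = p ↔
      (z i = p.1.1 ∧ z j = p.1.2) ∨ (z i = p.1.2 ∧ z j = p.1.1) := by
  unfold blockOf
  rw [← Equiv.eq_symm_apply]
  simp [Sym2.sortEquiv, Prod.ext_iff]

/-- `C_{(r,s)}`, a block of the partition of the 2-subsets of `[n]` induced by the clusters. -/
def edgeBlock (z : Fin n → Fin k) (p : Block k) : Finset (Edge n) :=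
  Finset.univ.filter fun e => blockOf z e = p

/-- `m_{r,s} = |C_{(r,s)}|`. -/
def blockSize (z : Fin n → Fin k) (p : Block k) : ℕ := (edgeBlock z p).card

/-- `m̂_{r,s} = |C_{(r,s)} ∩ E|`, where `E` is the edge set of the graph `G`. -/
def obsSize (z : Fin n → Fin k) (G : SimpleGraph (Fin n)) (p : Block k) : ℕ :=
  open Classical in ((edgeBlock z p).filter fun e => (e : Sym2 (Fin n)) ∈ G.edgeSet).card

/-- `Q`, the normalized block-membership matrix of the edges of `K_n`. -/
def Q (z : Fin n → Fin k) : Matrix (Edge n) (Block k) ℝ :=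
  Matrix.of fun e p => if blockOf z e = p then (Real.sqrt (blockSize z p))⁻¹ else 0

/-- `δ_e`, the indicator that `e` is an edge of `G`. -/
def delta (G : SimpleGraph (Fin n)) (e : Edge n) : ℝ :=
  open Classical in if (e : Sym2 (Fin n)) ∈ G.edgeSet then 1 else 0

/-- `P = diag(δ_e)`. -/
def projP (G : SimpleGraph (Fin n)) : Matrix (Edge n) (Edge n) ℝ := Matrix.diagonal (delta G)

/-- `√(m_{r,s} / m̂_{r,s})`, replaced by `1` when `m̂_{r,s} = 0`. -/
def rescale (z : Fin n → Fin k) (G : SimpleGraph (Fin n)) (p : Block k) : ℝ :=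
  if obsSize z G p = 0 then 1 else Real.sqrt ((blockSize z p : ℝ) / (obsSize z G p : ℝ))

/-- The zero-padded projection matrix of `G`, equal to `P Q diag(√(m_{r,s} / m̂_{r,s}))`. -/
def Qhat (z : Fin n → Fin k) (G : SimpleGraph (Fin n)) : Matrix (Edge n) (Block k) ℝ :=
  projP G * Q z * Matrix.diagonal (rescale z G)

/-- `Y_e = δ_e √(m_e / m̂_e)`. -/
def Y (z : Fin n → Fin k) (G : SimpleGraph (Fin n)) (e : Edge n) : ℝ :=
  delta G e * rescale z G (blockOf z e)

/-- `Qhat = diag(Y_e) Q`. -/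
theorem Qhat_eq_diagonal_mul (z : Fin n → Fin k) (G : SimpleGraph (Fin n)) :
    Qhat z G = Matrix.diagonal (Y z G) * Q z := by
  ext e p
  simp only [Qhat, projP, Matrix.mul_diagonal, Matrix.diagonal_mul, Y, Q, Matrix.of_apply]
  split_ifs with h
  · subst h; ring
  · simp

variable {Ω : Type*} [MeasurableSpace Ω]

/-- `μ_e = E[Y_e]`. -/
def muEdge (Pr : Measure Ω) (z : Fin n → Fin k) (G : Ω → SimpleGraph (Fin n)) (e : Edge n) : ℝ :=
  ∫ ω, Y z (G ω) e ∂Pr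

/-- `μ_{r,s}`: in a stochastic blockmodel, `μ_e` has the same value for all `e` in `C_{(r,s)}`,
and `μ_{r,s}` is this value. To avoid the choice of an edge, it is written as the mean over the
block; the theorem also asserts that every single `μ_e` of the block equals it. -/
def mu (Pr : Measure Ω) (z : Fin n → Fin k) (G : Ω → SimpleGraph (Fin n)) (p : Block k) : ℝ :=
  (∑ e ∈ edgeBlock z p, muEdge Pr z G e) / (blockSize z p : ℝ)

/-- The random matrix `H = A(L(K_n)) (Qhat - Q diag(μ_{r,s}))`. -/
def H (Pr : Measure Ω) (z : Fin n → Fin k) (G : Ω → SimpleGraph (Fin n)) (ω : Ω) :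
    Matrix (Edge n) (Block k) ℝ :=
  lineAdj n * (Qhat z (G ω) - Q z * Matrix.diagonal (mu Pr z G))

/-- The random graph `G` on `[n]` is a stochastic blockmodel with cluster assignment `z` and
probability matrix `B`: edges appear independently, and `{i,j}` appears with
probability `B_{z(i),z(j)}`. -/
structure IsSBM (Pr : Measure Ω) (z : Fin n → Fin k) (B : Matrix (Fin k) (Fin k) ℝ)
    (G : Ω → SimpleGraph (Fin n)) : Prop where
  measurableSet_edge : ∀ e : Edge n, MeasurableSet {ω | (e : Sym2 (Fin n)) ∈ (G ω).edgeSet}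
  indep : iIndepSet (fun e : Edge n => {ω | (e : Sym2 (Fin n)) ∈ (G ω).edgeSet}) Pr
  prob : ∀ i j : Fin n, i ≠ j → Pr.real {ω | (G ω).Adj i j} = B (z i) (z j)

end SBMLineGraph

end

noncomputable section

namespace SBMLineGraph

variable {n k : ℕ}

/-! Independence: column `p` of `H` is a function of the edge indicators in block `p` alone, and the
blocks are disjoint. The means agree within a block because swapping two of its edges preserves the
law of all indicators and the edge count of the block.

Norm bound: write q = n^(1/4), b = B_{r,s}, ρ = √(m/m̂). An entry of `H` is m^(-1/2) times a sum of
Y_f - μ over a star, the at most 2n edges of one block adjacent to a given edge. That sum is ρ ∑(δ_f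
- b) + |star| (bρ - μ). By Hoeffding, outside probability O(1/n) all star sums of δ_f - b are below
q^3 and all block sums below q^5 (`measure_not_concentrated_le`). The block sums put ρ near 1/√b.
Averaging Y over a block gives μ = E√(m̂/m), so μ is near √b (`abs_mu_sub_sqrt_le`). Hence bρ - μ =
O(1/q) and star sums are O(q^3) (`abs_sum_star_le`). Since m ≥ κ n², entries are O(1/q), and at most
n²k² of them give a Frobenius norm O(q^3). Blocks with b = 0 contribute nothing almost surely;
elsewhere b ≥ β > 0. -/

/-! ### Edge counts and entries of `H` in terms of the indicators -/

/-- `√(m / s)` with the convention that it is `1` at `s = 0`. -/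
def invSqrtRatio (m s : ℝ) : ℝ := if s = 0 then 1 else Real.sqrt (m / s)

theorem measurable_invSqrtRatio (m : ℝ) : Measurable (invSqrtRatio m) := by
  unfold invSqrtRatio
  exact Measurable.ite (measurableSet_singleton 0) measurable_const
    (by fun_prop)

theorem delta_mem_Icc (G : SimpleGraph (Fin n)) (e : Edge n) : delta G e ∈ Set.Icc (0 : ℝ) 1 := by
  unfold delta
  split_ifs <;> simp

-- The filter in `obsSize` runs over the image of the block in `Sym2 (Fin n)`; injectivity of the
-- coercion brings it back to `Edge n`.
open Classical in
theorem obsSize_eq_card (z : Fin n → Fin k) (G : SimpleGraph (Fin n)) (p : Block k) :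
    obsSize z G p =
      ((edgeBlock z p).filter fun e : Edge n => (e : Sym2 (Fin n)) ∈ G.edgeSet).card := by
  unfold obsSize
  rw [← Finset.card_image_of_injective _ (Subtype.val_injective (p := fun e : Sym2 (Fin n) =>
    e ∈ (⊤ : SimpleGraph (Fin n)).edgeSet))]
  congr 1
  ext x
  simp only [Finset.mem_filter, Finset.mem_image, Finset.bind_def, Finset.pure_def,
    Finset.mem_sup, Finset.mem_singleton]
  constructor
  · rintro ⟨⟨e, he, rfl⟩, h⟩
    exact ⟨e, ⟨he, h⟩, rfl⟩
  · rintro ⟨e, ⟨he, h⟩, rfl⟩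
    exact ⟨⟨e, he, rfl⟩, h⟩

theorem obsSize_eq_sum_delta (z : Fin n → Fin k) (G : SimpleGraph (Fin n)) (p : Block k) :
    (obsSize z G p : ℝ) = ∑ f ∈ edgeBlock z p, delta G f := by
  rw [obsSize_eq_card]
  unfold delta
  rw [Finset.card_filter]
  push_cast
  rfl

theorem rescale_eq_invSqrtRatio (z : Fin n → Fin k) (G : SimpleGraph (Fin n)) (p : Block k) :
    rescale z G p = invSqrtRatio (blockSize z p) (∑ f ∈ edgeBlock z p, delta G f) := by
  rw [← obsSize_eq_sum_delta]
  simp [rescale, invSqrtRatio]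

theorem mem_edgeBlock {z : Fin n → Fin k} {p : Block k} {e : Edge n} :
    e ∈ edgeBlock z p ↔ blockOf z e = p := by
  simp [edgeBlock]

theorem rescale_nonneg (z : Fin n → Fin k) (G : SimpleGraph (Fin n)) (p : Block k) :
    0 ≤ rescale z G p := by
  unfold rescale
  split_ifs
  · exact zero_le_one
  · exact Real.sqrt_nonneg _

theorem sum_Y_edgeBlock (z : Fin n → Fin k) (G : SimpleGraph (Fin n)) (p : Block k) :
    ∑ e ∈ edgeBlock z p, Y z G e = obsSize z G p * rescale z G p := by
  rw [obsSize_eq_sum_delta, Finset.sum_mul]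
  exact Finset.sum_congr rfl fun e he => by rw [Y, mem_edgeBlock.1 he]

theorem obsSize_le_blockSize (z : Fin n → Fin k) (G : SimpleGraph (Fin n)) (p : Block k) :
    obsSize z G p ≤ blockSize z p := by
  classical
  rw [obsSize_eq_card]
  exact Finset.card_filter_le _ _

/-- Both sides are √(m m̂), and both vanish at m̂ = 0, so the convention there does no harm. -/
theorem obsSize_mul_rescale (z : Fin n → Fin k) (G : SimpleGraph (Fin n)) (p : Block k) :
    obsSize z G p * rescale z G p =
      blockSize z p * Real.sqrt ((obsSize z G p : ℝ) / blockSize z p) := by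
  unfold rescale
  split_ifs with h
  · simp [h]
  · have h1 : (0 : ℝ) < obsSize z G p := by exact_mod_cast Nat.pos_of_ne_zero h
    have h2 : (0 : ℝ) < blockSize z p :=
      h1.trans_le (by exact_mod_cast obsSize_le_blockSize z G p)
    rw [Real.sqrt_div h2.le, Real.sqrt_div h1.le]
    have h3 := Real.sqrt_pos.2 h1
    have h4 := Real.sqrt_pos.2 h2
    field_simp
    rw [Real.sq_sqrt h1.le, Real.sq_sqrt h2.le]

theorem H_apply {Ω : Type*} [MeasurableSpace Ω] (Pr : Measure Ω) (z : Fin n → Fin k)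
    (G : Ω → SimpleGraph (Fin n)) (ω : Ω) (e : Edge n) (p : Block k) :
    H Pr z G ω e p =
      (∑ f ∈ edgeBlock z p, lineAdj n e f * (Y z (G ω) f - mu Pr z G p)) *
        (Real.sqrt (blockSize z p))⁻¹ := by
  rw [H, Qhat_eq_diagonal_mul, Matrix.mul_apply, edgeBlock, Finset.sum_filter, Finset.sum_mul]
  refine Finset.sum_congr rfl fun f _ => ?_
  simp only [Matrix.sub_apply, Matrix.diagonal_mul, Matrix.mul_diagonal, Q, Matrix.of_apply]
  split_ifs <;> ring

/-! ### Exchangeability within blocks and independence of columns -/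

section Law

/-- Families of independent random variables over pairwise disjoint index sets are independent. -/
theorem iIndepFun_restrict_of_pairwise_disjoint {Ω ι κ β : Type*} [MeasurableSpace Ω]
    [MeasurableSpace β] {Pr : Measure Ω} {f : ι → Ω → β} (hf : ∀ i, Measurable (f i))
    (hind : iIndepFun f Pr) {S : κ → Finset ι} (hS : Pairwise fun p q => Disjoint (S p) (S q)) :
    iIndepFun (fun p ω (i : S p) => f i ω) Pr := by
  classical
  have := hind.isProbabilityMeasure
  have hle : ∀ i, MeasurableSpace.comap (f i) inferInstance ≤ ‹MeasurableSpace Ω› :=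
    fun i => (hf i).comap_le
  have hind' := (iIndepFun_iff_iIndep _ _ _).1 hind
  have hmeas : ∀ p (A : Set (S p → β)), MeasurableSet A →
      MeasurableSet[⨆ i ∈ (S p : Set ι), MeasurableSpace.comap (f i) inferInstance]
        ((fun ω (i : S p) => f i ω) ⁻¹' A) := by
    intro p A hA
    have : Measurable[⨆ i ∈ (S p : Set ι), MeasurableSpace.comap (f i) inferInstance]
        (fun ω (i : S p) => f i ω) := by
      refine @measurable_pi_lambda _ _ _ (_) _ _ fun i => ?_
      refine (comap_measurable (f i)).mono ?_ le_rfl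
      exact le_iSup₂_of_le (i : ι) i.2 le_rfl
    exact this hA
  rw [iIndepFun_iff_measure_inter_preimage_eq_mul]
  intro T
  induction T using Finset.induction_on with
  | empty => simp
  | insert p T hp ih =>
    intro A hA
    rw [Finset.set_biInter_insert, Finset.prod_insert hp,
      ← ih fun q hq => hA q (Finset.mem_insert_of_mem hq)]
    have hd : Disjoint (S p : Set ι) (⋃ q ∈ T, (S q : Set ι)) := by
      refine Set.disjoint_iUnion₂_right.2 fun q hq => ?_
      exact_mod_cast hS (ne_of_mem_of_not_mem hq hp).symm
    -- The event for `p` is measurable for the indices in `S p`, the remaining intersection for the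
    -- union of the other `S q`; these index sets are disjoint.
    refine (Indep_iff _ _ _ |>.1 (indep_iSup_of_disjoint hle hind' hd) _ _
      (hmeas p _ (hA p (Finset.mem_insert_self _ _))) ?_)
    refine Finset.measurableSet_biInter _ fun q hq => ?_
    refine (iSup₂_le fun i hi => ?_ :
      (⨆ i ∈ (S q : Set ι), MeasurableSpace.comap (f i) inferInstance) ≤ _) _
      (hmeas q _ (hA q (Finset.mem_insert_of_mem hq)))
    exact le_iSup₂_of_le i (Set.mem_biUnion hq hi) le_rfl

variable {Ω : Type*} [MeasurableSpace Ω] {Pr : Measure Ω}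
  {z : Fin n → Fin k} {B : Matrix (Fin k) (Fin k) ℝ} {G : Ω → SimpleGraph (Fin n)}

omit [MeasurableSpace Ω] in
theorem delta_eq_indicator (G : Ω → SimpleGraph (Fin n)) (e : Edge n) :
    (fun ω => delta (G ω) e) =
      {ω | (e : Sym2 (Fin n)) ∈ (G ω).edgeSet}.indicator fun _ => (1 : ℝ) := by
  ext ω
  by_cases h : (e : Sym2 (Fin n)) ∈ (G ω).edgeSet
  · rw [delta, if_pos h, Set.indicator_of_mem (by exact h)]
  · rw [delta, if_neg h, Set.indicator_of_notMem (by exact h)]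

theorem IsSBM.measurable_delta (hG : IsSBM Pr z B G) (e : Edge n) :
    Measurable fun ω => delta (G ω) e := by
  rw [delta_eq_indicator]
  exact measurable_const.indicator (hG.measurableSet_edge e)

theorem IsSBM.iIndepFun_delta (hG : IsSBM Pr z B G) :
    iIndepFun (fun (e : Edge n) ω => delta (G ω) e) Pr := by
  rw [show (fun (e : Edge n) ω => delta (G ω) e) = _ from funext (delta_eq_indicator G)]
  exact hG.indep.iIndepFun_indicator

theorem IsSBM.prob_edge (hG : IsSBM Pr z B G) (e : Edge n) :
    Pr.real {ω | (e : Sym2 (Fin n)) ∈ (G ω).edgeSet} =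
      B (blockOf z e).1.1 (blockOf z e).1.2 := by
  obtain ⟨e, he⟩ := e
  induction e with
  | h i j =>
    have hij : i ≠ j := by simpa using he
    obtain ⟨h1, h2⟩ | ⟨h1, h2⟩ := (blockOf_eq_iff z i j he _).1 rfl
    · rw [← h1, ← h2, ← hG.prob i j hij]
      rfl
    · rw [← h1, ← h2, ← hG.prob j i hij.symm]
      simp_rw [SimpleGraph.adj_comm _ j i]
      rfl

theorem IsSBM.integral_delta (hG : IsSBM Pr z B G) (e : Edge n) :
    ∫ ω, delta (G ω) e ∂Pr = B (blockOf z e).1.1 (blockOf z e).1.2 := by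
  rw [delta_eq_indicator, integral_indicator_const _ (hG.measurableSet_edge e), hG.prob_edge]
  simp

theorem identDistrib_indicator_one [IsProbabilityMeasure Pr] {s t : Set Ω} (hs : MeasurableSet s)
    (ht : MeasurableSet t) (h : Pr.real s = Pr.real t) :
    IdentDistrib (s.indicator fun _ => (1 : ℝ)) (t.indicator fun _ => (1 : ℝ)) Pr Pr := by
  refine ⟨(measurable_const.indicator hs).aemeasurable, (measurable_const.indicator ht).aemeasurable,
    ?_⟩
  have h0 : Pr s = Pr t := (measureReal_eq_measureReal_iff).1 h
  have h1 : Pr sᶜ = Pr tᶜ := by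
    rw [measure_compl hs (measure_ne_top _ _), measure_compl ht (measure_ne_top _ _), h0]
  ext A hA
  rw [Measure.map_apply (measurable_const.indicator hs) hA,
    Measure.map_apply (measurable_const.indicator ht) hA]
  classical
  by_cases a1 : (1 : ℝ) ∈ A <;> by_cases a0 : (0 : ℝ) ∈ A <;>
    simp [Set.indicator_const_preimage_eq_union, a1, a0, h0, h1]

theorem IsSBM.identDistrib_delta [IsProbabilityMeasure Pr] (hG : IsSBM Pr z B G) {e f : Edge n}
    (h : blockOf z e = blockOf z f) :
    IdentDistrib (fun ω => delta (G ω) e) (fun ω => delta (G ω) f) Pr Pr := by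
  rw [delta_eq_indicator, delta_eq_indicator]
  exact identDistrib_indicator_one (hG.measurableSet_edge e) (hG.measurableSet_edge f)
    (by rw [hG.prob_edge, hG.prob_edge, h])

/-- The edge indicators are exchangeable within the blocks. -/
theorem IsSBM.identDistrib_delta_perm [IsProbabilityMeasure Pr] (hG : IsSBM Pr z B G)
    (σ : Equiv.Perm (Edge n)) (hσ : ∀ e, blockOf z (σ e) = blockOf z e) :
    IdentDistrib (fun ω e => delta (G ω) e) (fun ω e => delta (G ω) (σ e)) Pr Pr :=
  IdentDistrib.pi (fun e => hG.identDistrib_delta (hσ e).symm) hG.iIndepFun_delta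
    (hG.iIndepFun_delta.precomp σ.injective)

theorem Y_eq_of_delta (z : Fin n → Fin k) (G : SimpleGraph (Fin n)) (e : Edge n) :
    Y z G e = delta G e * invSqrtRatio (blockSize z (blockOf z e))
      (∑ f ∈ edgeBlock z (blockOf z e), delta G f) := by
  rw [Y, rescale_eq_invSqrtRatio]

/-- The transposition of `e` and `f` preserves the joint law of the indicators and the block sum,
and carries Y_e to Y_f. -/
theorem IsSBM.muEdge_eq_of_blockOf_eq [IsProbabilityMeasure Pr] (hG : IsSBM Pr z B G)
    {e f : Edge n} (h : blockOf z e = blockOf z f) : muEdge Pr z G e = muEdge Pr z G f := by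
  classical
  have hσ : ∀ g, blockOf z (Equiv.swap e f g) = blockOf z g := by
    intro g
    by_cases h1 : g = e
    · rw [h1, Equiv.swap_apply_left, h]
    by_cases h2 : g = f
    · rw [h2, Equiv.swap_apply_right, h]
    rw [Equiv.swap_apply_of_ne_of_ne h1 h2]
  set F : (Edge n → ℝ) → ℝ := fun x => x e * invSqrtRatio (blockSize z (blockOf z e))
      (∑ g ∈ edgeBlock z (blockOf z e), x g) with hF
  have hFm : Measurable F := (measurable_pi_apply e).mul
    ((measurable_invSqrtRatio _).comp (by fun_prop))
  have hI := ((hG.identDistrib_delta_perm (Equiv.swap e f) hσ).comp hFm).integral_eq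
  simp only [Function.comp_def, hF, Equiv.swap_apply_left] at hI
  have hsum : ∀ ω, ∑ g ∈ edgeBlock z (blockOf z e), delta (G ω) (Equiv.swap e f g) =
      ∑ g ∈ edgeBlock z (blockOf z e), delta (G ω) g := fun ω =>
    Finset.sum_equiv (Equiv.swap e f) (by simp [mem_edgeBlock, hσ]) (by simp)
  simp only [hsum] at hI
  simp only [muEdge, Y_eq_of_delta]
  rw [hI, h]

theorem IsSBM.muEdge_eq_mu [IsProbabilityMeasure Pr] (hG : IsSBM Pr z B G) (e : Edge n) :
    muEdge Pr z G e = mu Pr z G (blockOf z e) := by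
  have hmem : e ∈ edgeBlock z (blockOf z e) := mem_edgeBlock.2 rfl
  have hpos : (0 : ℝ) < blockSize z (blockOf z e) := by
    exact_mod_cast Finset.card_pos.2 ⟨e, hmem⟩
  rw [mu, Finset.sum_congr rfl fun f hf => hG.muEdge_eq_of_blockOf_eq (mem_edgeBlock.1 hf),
    Finset.sum_const, nsmul_eq_mul, ← blockSize, mul_div_cancel_left₀ _ hpos.ne']

theorem IsSBM.iIndepFun_columns (hG : IsSBM Pr z B G) :
    iIndepFun (fun (p : Block k) ω (e : Edge n) => H Pr z G ω e p) Pr := by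
  classical
  -- Column `p` as an explicit measurable function of the indicators in block `p`; `mu` enters as a
  -- constant.
  set φ : (p : Block k) → (edgeBlock z p → ℝ) → Edge n → ℝ := fun p x e =>
    (∑ f : edgeBlock z p, lineAdj n e f *
      (x f * invSqrtRatio (blockSize z p) (∑ g, x g) - mu Pr z G p)) *
        (Real.sqrt (blockSize z p))⁻¹ with hφ
  have hφm : ∀ p, Measurable (φ p) := fun p => by
    refine measurable_pi_lambda _ fun e => (Finset.measurable_sum _ fun f _ => ?_).mul_const _
    refine (((measurable_pi_apply f).mul
      ((measurable_invSqrtRatio _).comp (by fun_prop))).sub_const _).const_mul _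
  have hdisj : Pairwise fun p q : Block k => Disjoint (edgeBlock z p) (edgeBlock z q) := by
    intro p q hpq
    refine Finset.disjoint_left.2 fun e hp hq => hpq ?_
    rw [← mem_edgeBlock.1 hp, mem_edgeBlock.1 hq]
  have := (iIndepFun_restrict_of_pairwise_disjoint hG.measurable_delta hG.iIndepFun_delta
    hdisj).comp φ hφm
  convert this using 4 with p ω e
  have hs := Finset.sum_coe_sort (edgeBlock z p) fun g => delta (G ω) g
  rw [H_apply, Function.comp_apply, ← Finset.sum_coe_sort (edgeBlock z p), hφ]
  dsimp only
  rw [hs, ← rescale_eq_invSqrtRatio]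
  congr 1
  exact Finset.sum_congr rfl fun f _ => by rw [Y, mem_edgeBlock.1 f.2]

end Law

/-! ### Sizes of stars and blocks -/

section Counting

theorem card_edge_le (n : ℕ) : Fintype.card (Edge n) ≤ n ^ 2 := by
  classical
  have hsurj : ∀ e : Edge n, ∃ x : Fin n × Fin n, s(x.1, x.2) = (e : Sym2 (Fin n)) := by
    rintro ⟨e, he⟩
    induction e with
    | h i j => exact ⟨(i, j), rfl⟩
  choose g hg using hsurj
  have hinj : Function.Injective g := fun e f h => Subtype.ext (by rw [← hg e, ← hg f, h])
  calc Fintype.card (Edge n) ≤ Fintype.card (Fin n × Fin n) := Fintype.card_le_of_injective g hinj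
    _ = n ^ 2 := by simp [sq]

theorem card_block_le (k : ℕ) : Fintype.card (Block k) ≤ k ^ 2 :=
  (Fintype.card_subtype_le _).trans_eq (by simp [sq])

open Classical in
/-- The edges of the block `p` that are adjacent to `e` in the line graph. -/
def star (z : Fin n → Fin k) (e : Edge n) (p : Block k) : Finset (Edge n) :=
  (edgeBlock z p).filter fun f => (⊤ : SimpleGraph (Fin n)).lineGraph.Adj e f

/-- A neighbour of {i,j} contains i or j, which leaves at most n choices for its other endpoint in
each case. -/
theorem card_star_le (z : Fin n → Fin k) (e : Edge n) (p : Block k) :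
    (star z e p).card ≤ 2 * n := by
  classical
  obtain ⟨e, he⟩ := e
  induction e with
  | h i j =>
    have hsub : (star z ⟨s(i, j), he⟩ p).image Subtype.val ⊆
        (Finset.univ.image fun w : Fin n => s(i, w)) ∪
          Finset.univ.image fun w : Fin n => s(j, w) := by
      intro x hx
      obtain ⟨f, hf, rfl⟩ := Finset.mem_image.1 hx
      obtain ⟨-, v, hv, hvf⟩ := SimpleGraph.lineGraph_adj_iff_exists.1 (Finset.mem_filter.1 hf).2
      obtain ⟨w, hw⟩ := hvf
      rw [Finset.mem_union, hw]
      obtain rfl | rfl := Sym2.mem_iff.1 hv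
      · exact Or.inl (Finset.mem_image_of_mem _ (Finset.mem_univ w))
      · exact Or.inr (Finset.mem_image_of_mem _ (Finset.mem_univ w))
    calc (star z ⟨s(i, j), he⟩ p).card
        = ((star z ⟨s(i, j), he⟩ p).image Subtype.val).card :=
          (Finset.card_image_of_injective _ Subtype.val_injective).symm
      _ ≤ _ := Finset.card_le_card hsub
      _ ≤ _ := Finset.card_union_le _ _
      _ ≤ n + n := add_le_add (Finset.card_image_le.trans_eq (by simp))
          (Finset.card_image_le.trans_eq (by simp))
      _ = 2 * n := (two_mul n).symm

theorem blockSize_le (z : Fin n → Fin k) (p : Block k) : blockSize z p ≤ n ^ 2 :=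
  (Finset.card_le_univ _).trans (card_edge_le n)

/-- Count ordered pairs of distinct vertices: there are at least n_r (n_s - 1), and each edge comes
from at most two. Since n_s ≥ 2, n_s ≤ 2 (n_s - 1), hence the factor 4. -/
theorem clusterSize_mul_le (z : Fin n → Fin k) (hz : ∀ r, 2 ≤ clusterSize z r) (p : Block k) :
    clusterSize z p.1.1 * clusterSize z p.1.2 ≤ 4 * blockSize z p := by
  classical
  set S : Finset (Fin n × Fin n) := Finset.univ.filter fun x =>
    z x.1 = p.1.1 ∧ z x.2 = p.1.2 ∧ x.1 ≠ x.2 with hS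
  have h1 : clusterSize z p.1.1 * (clusterSize z p.1.2 - 1) ≤ S.card := by
    have hfib : ∀ i ∈ Finset.univ.filter (fun i => z i = p.1.1),
        clusterSize z p.1.2 - 1 ≤ (S.filter fun x => x.1 = i).card := by
      intro i hi
      have hsub : (((Finset.univ.filter fun j => z j = p.1.2).erase i).image fun j => (i, j)) ⊆
          S.filter fun x => x.1 = i := by
        intro x hx
        obtain ⟨j, hj, rfl⟩ := Finset.mem_image.1 hx
        simp only [Finset.mem_erase, Finset.mem_filter, Finset.mem_univ, true_and] at hj hi
        simp [hS, hi, hj.2, Ne.symm hj.1]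
      refine le_trans ?_ (Finset.card_le_card hsub)
      rw [Finset.card_image_of_injective _ (Prod.mk_right_injective i)]
      exact Finset.pred_card_le_card_erase
    rw [mul_comm]
    refine Finset.mul_card_image_le_card_of_maps_to (f := Prod.fst)
      (t := Finset.univ.filter fun i => z i = p.1.1) (fun x hx => ?_) _ hfib
    simpa using (Finset.mem_filter.1 hx).2.1
  have h2 : S.card ≤ 2 * blockSize z p := by
    have hsub : S.image (fun x => s(x.1, x.2)) ⊆ (edgeBlock z p).image Subtype.val := by
      intro x hx
      obtain ⟨⟨i, j⟩, hij, rfl⟩ := Finset.mem_image.1 hx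
      obtain ⟨-, hi, hj, hne⟩ := Finset.mem_filter.1 hij
      refine Finset.mem_image.2 ⟨⟨s(i, j), by simpa using hne⟩, ?_, rfl⟩
      exact mem_edgeBlock.2 ((blockOf_eq_iff z i j _ p).2 (Or.inl ⟨hi, hj⟩))
    refine (Finset.card_le_mul_card_image (f := fun x : Fin n × Fin n => s(x.1, x.2)) S 2
      fun a _ => ?_).trans (Nat.mul_le_mul_left 2
        ((Finset.card_le_card hsub).trans Finset.card_image_le))
    induction a with
    | h i j =>
      refine (Finset.card_le_card (t := {(i, j), (j, i)}) ?_).trans Finset.card_le_two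
      rintro ⟨a, b⟩ hab
      have := (Finset.mem_filter.1 hab).2
      simpa [Sym2.eq_iff] using this
  have h3 := hz p.1.2
  obtain ⟨y, hy⟩ : ∃ y, clusterSize z p.1.2 = y + 2 := ⟨_, (Nat.sub_add_cancel h3).symm⟩
  rw [hy] at h1 ⊢
  rw [show y + 2 - 1 = y + 1 from rfl] at h1
  nlinarith

theorem le_blockSize {c : ℝ} (hc : 0 < c) (z : Fin n → Fin k) (hz : ∀ r, 2 ≤ clusterSize z r)
    (hzc : ∀ r, c * n ≤ clusterSize z r) (p : Block k) :
    c ^ 2 / 4 * (n : ℝ) ^ 2 ≤ blockSize z p := by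
  have h1 : (clusterSize z p.1.1 : ℝ) * clusterSize z p.1.2 ≤ 4 * blockSize z p := by
    exact_mod_cast clusterSize_mul_le z hz p
  have h2 : (c * n) * (c * n) ≤ (clusterSize z p.1.1 : ℝ) * clusterSize z p.1.2 :=
    mul_le_mul (hzc _) (hzc _) (by positivity) (by positivity)
  nlinarith

theorem lineAdj_sum (z : Fin n → Fin k) (e : Edge n) (p : Block k) (x : Edge n → ℝ) :
    ∑ f ∈ edgeBlock z p, lineAdj n e f * x f = ∑ f ∈ star z e p, x f := by
  classical
  rw [star, Finset.sum_filter]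
  refine Finset.sum_congr rfl fun f _ => ?_
  unfold lineAdj
  rw [SimpleGraph.adjMatrix_apply]
  split_ifs <;> simp

end Counting

/-! ### Hoeffding bounds and the value of μ -/

section Concentration

variable {Ω : Type*} [MeasurableSpace Ω] {Pr : Measure Ω} [IsProbabilityMeasure Pr]
  {z : Fin n → Fin k} {B : Matrix (Fin k) (Fin k) ℝ} {G : Ω → SimpleGraph (Fin n)}

theorem IsSBM.measure_sum_delta_ge_le (hG : IsSBM Pr z B G) (S : Finset (Edge n)) {M t : ℝ}
    (hS : (S.card : ℝ) ≤ M) (ht : 0 < t) :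
    Pr.real {ω | t ≤ |∑ e ∈ S, (delta (G ω) e - B (blockOf z e).1.1 (blockOf z e).1.2)|} ≤
      2 * Real.exp (-(2 * t ^ 2 / M)) := by
  set X : Edge n → Ω → ℝ := fun e ω => delta (G ω) e - B (blockOf z e).1.1 (blockOf z e).1.2
    with hX
  obtain rfl | hne := S.eq_empty_or_nonempty
  · simp [not_le.2 ht]
    positivity
  -- A variable with values in [0,1] has variance proxy 1/4, so the sum has |S|/4.
  have hsub : ∀ e, HasSubgaussianMGF (X e) ((‖(1 : ℝ) - 0‖₊ / 2) ^ 2) Pr := by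
    intro e
    have := hasSubgaussianMGF_of_mem_Icc (μ := Pr) (hG.measurable_delta e).aemeasurable
      (ae_of_all _ fun ω => delta_mem_Icc (G ω) e)
    rwa [hG.integral_delta] at this
  have hind : iIndepFun X Pr := hG.iIndepFun_delta.comp
    (fun e x => x - B (blockOf z e).1.1 (blockOf z e).1.2) fun e => by fun_prop
  have hc : (0 : ℝ) < S.card := by exact_mod_cast hne.card_pos
  have hsum := HasSubgaussianMGF.sum_of_iIndepFun hind (s := S) fun e _ => hsub e
  have hexp : Real.exp (-t ^ 2 / (2 * ((∑ _e ∈ S, ((‖(1 : ℝ) - 0‖₊ / 2) ^ 2) : NNReal) : ℝ))) ≤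
      Real.exp (-(2 * t ^ 2 / M)) := by
    refine Real.exp_le_exp.2 ?_
    have : (2 * ((∑ _e ∈ S, ((‖(1 : ℝ) - 0‖₊ / 2) ^ 2) : NNReal) : ℝ)) = S.card / 2 := by
      simp
      ring
    rw [this, neg_div, neg_le_neg_iff, div_div_eq_mul_div, mul_comm]
    gcongr
  have hp := (hsum.measure_ge_le ht.le).trans hexp
  have hn := (hsum.neg.measure_ge_le ht.le).trans hexp
  calc _ ≤ Pr.real ({ω | t ≤ ∑ e ∈ S, X e ω} ∪
        {ω | t ≤ (-fun ω => ∑ e ∈ S, X e ω) ω}) := by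
        refine measureReal_mono fun ω hω => ?_
        exact le_abs.1 (Set.mem_ofPred.1 hω)
    _ ≤ _ := measureReal_union_le _ _
    _ ≤ _ := by rw [two_mul]; exact add_le_add hp hn

theorem IsSBM.ae_delta_eq_zero (hG : IsSBM Pr z B G) (e : Edge n)
    (h : B (blockOf z e).1.1 (blockOf z e).1.2 = 0) : ∀ᵐ ω ∂Pr, delta (G ω) e = 0 := by
  have h0 := hG.integral_delta e
  rw [h, integral_eq_zero_iff_of_nonneg (fun ω => (delta_mem_Icc (G ω) e).1)
    (Integrable.of_mem_Icc 0 1 (hG.measurable_delta e).aemeasurable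
      (ae_of_all _ fun ω => delta_mem_Icc (G ω) e))] at h0
  exact h0

theorem IsSBM.mu_eq_zero (hG : IsSBM Pr z B G) (p : Block k) (h : B p.1.1 p.1.2 = 0) :
    mu Pr z G p = 0 := by
  rw [mu, Finset.sum_eq_zero, zero_div]
  intro e he
  rw [← mem_edgeBlock.1 he] at h
  refine integral_eq_zero_of_ae ?_
  filter_upwards [hG.ae_delta_eq_zero e h] with ω hω
  simp [Y, hω]

omit [IsProbabilityMeasure Pr] in
theorem IsSBM.measurable_obsSize (hG : IsSBM Pr z B G) (p : Block k) :
    Measurable fun ω => (obsSize z (G ω) p : ℝ) := by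
  simp_rw [obsSize_eq_sum_delta]
  exact Finset.measurable_sum _ fun e _ => hG.measurable_delta e

omit [IsProbabilityMeasure Pr] in
theorem IsSBM.measurable_rescale (hG : IsSBM Pr z B G) (p : Block k) :
    Measurable fun ω => rescale z (G ω) p := by
  simp_rw [rescale_eq_invSqrtRatio]
  exact (measurable_invSqrtRatio _).comp (Finset.measurable_sum _ fun e _ => hG.measurable_delta e)

/-- A crude bound, used only for integrability: a nonzero m̂ is at least 1. -/
theorem rescale_le (z : Fin n → Fin k) (G : SimpleGraph (Fin n)) (p : Block k) :
    rescale z G p ≤ 1 + blockSize z p := by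
  unfold rescale
  split_ifs with h
  · simp
  · have h1 : (1 : ℝ) ≤ obsSize z G p := by exact_mod_cast Nat.one_le_iff_ne_zero.2 h
    have h2 : (0 : ℝ) ≤ blockSize z p := Nat.cast_nonneg _
    refine Real.sqrt_le_iff.2 ⟨by positivity, ?_⟩
    exact (div_le_self h2 h1).trans (by nlinarith)

theorem IsSBM.mu_eq_integral (hG : IsSBM Pr z B G) (p : Block k) (hp : 0 < blockSize z p) :
    mu Pr z G p = ∫ ω, Real.sqrt ((obsSize z (G ω) p : ℝ) / blockSize z p) ∂Pr := by
  have hint : ∀ e ∈ edgeBlock z p, Integrable (fun ω => Y z (G ω) e) Pr := by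
    intro e _
    refine Integrable.of_mem_Icc 0 (1 + blockSize z (blockOf z e))
      ((hG.measurable_delta e).mul (hG.measurable_rescale _)).aemeasurable
      (ae_of_all _ fun ω => ?_)
    have h1 := delta_mem_Icc (G ω) e
    have h2 := rescale_nonneg z (G ω) (blockOf z e)
    exact ⟨mul_nonneg h1.1 h2, (mul_le_of_le_one_left h2 h1.2).trans (rescale_le _ _ _)⟩
  have hp' : (blockSize z p : ℝ) ≠ 0 := by exact_mod_cast hp.ne'
  unfold mu muEdge
  rw [← integral_finsetSum _ hint]
  simp_rw [sum_Y_edgeBlock, obsSize_mul_rescale]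
  rw [integral_const_mul, mul_div_cancel_left₀ _ hp']

theorem abs_sqrt_sub_sqrt_le {x b : ℝ} (hx : 0 ≤ x) (hb : 0 < b) :
    |Real.sqrt x - Real.sqrt b| ≤ |x - b| / Real.sqrt b := by
  have hs := Real.sqrt_pos.2 hb
  have h : x - b = (Real.sqrt x - Real.sqrt b) * (Real.sqrt x + Real.sqrt b) := by
    nlinarith [Real.sq_sqrt hx, Real.sq_sqrt hb.le]
  rw [le_div_iff₀ hs, h, abs_mul]
  refine mul_le_mul_of_nonneg_left ?_ (abs_nonneg _)
  exact (le_add_of_nonneg_left (Real.sqrt_nonneg x)).trans (le_abs_self _)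

theorem sum_delta_sub_edgeBlock (z : Fin n → Fin k) (B : Matrix (Fin k) (Fin k) ℝ)
    (G : SimpleGraph (Fin n)) (p : Block k) :
    ∑ e ∈ edgeBlock z p, (delta G e - B (blockOf z e).1.1 (blockOf z e).1.2) =
      obsSize z G p - B p.1.1 p.1.2 * blockSize z p := by
  rw [Finset.sum_sub_distrib, obsSize_eq_sum_delta, blockSize, mul_comm, ← nsmul_eq_mul,
    ← Finset.sum_const]
  congr 1
  exact Finset.sum_congr rfl fun e he => by rw [mem_edgeBlock.1 he]

/-- Split the expectation of |√(m̂/m) - √b| by whether m̂ deviates from bm by at least t. If so, the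
difference is at most 1 and Hoeffding bounds the probability; if not, `abs_sqrt_sub_sqrt_le`
applies. -/
theorem IsSBM.abs_mu_sub_sqrt_le (hG : IsSBM Pr z B G) (hB : ∀ r s, B r s ∈ Set.Icc (0 : ℝ) 1)
    (p : Block k) (hp : 0 < blockSize z p) (hb : 0 < B p.1.1 p.1.2) {t : ℝ} (ht : 0 < t) :
    |mu Pr z G p - Real.sqrt (B p.1.1 p.1.2)| ≤
      t / blockSize z p / Real.sqrt (B p.1.1 p.1.2) +
        2 * Real.exp (-(2 * t ^ 2 / (n : ℝ) ^ 2)) := by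
  set b := B p.1.1 p.1.2 with hb'
  have hp' : (0 : ℝ) < blockSize z p := by exact_mod_cast hp
  set T : Set Ω := {ω | t ≤ |(obsSize z (G ω) p : ℝ) - b * blockSize z p|} with hT
  have hTm : MeasurableSet T := by
    have := hG.measurable_obsSize p
    exact measurableSet_le measurable_const (by fun_prop)
  have hTle : Pr.real T ≤ 2 * Real.exp (-(2 * t ^ 2 / (n : ℝ) ^ 2)) := by
    have := hG.measure_sum_delta_ge_le (edgeBlock z p) (M := (n : ℝ) ^ 2)
      (by exact_mod_cast blockSize_le z p) ht
    simpa only [sum_delta_sub_edgeBlock] using this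
  set a : Ω → ℝ := fun ω => Real.sqrt ((obsSize z (G ω) p : ℝ) / blockSize z p) with ha
  have ham : Measurable a := by
    have := hG.measurable_obsSize p
    fun_prop
  have ha01 : ∀ ω, a ω ∈ Set.Icc (0 : ℝ) 1 := fun ω => by
    refine ⟨Real.sqrt_nonneg _, Real.sqrt_le_one.2 ?_⟩
    exact div_le_one_of_le₀ (by exact_mod_cast obsSize_le_blockSize z (G ω) p) hp'.le
  have hai : Integrable a Pr := Integrable.of_mem_Icc 0 1 ham.aemeasurable (ae_of_all _ ha01)
  have hsb : Real.sqrt b ∈ Set.Icc (0 : ℝ) 1 :=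
    ⟨Real.sqrt_nonneg _, Real.sqrt_le_one.2 (hB _ _).2⟩
  have hpt : ∀ ω, |a ω - Real.sqrt b| ≤
      t / blockSize z p / Real.sqrt b + T.indicator (fun _ => (1 : ℝ)) ω := by
    intro ω
    by_cases hω : ω ∈ T
    · rw [Set.indicator_of_mem hω]
      have h1 : |a ω - Real.sqrt b| ≤ 1 :=
        abs_sub_le_iff.2 ⟨by linarith [(ha01 ω).2, hsb.1], by linarith [(ha01 ω).1, hsb.2]⟩
      have h2 : 0 ≤ t / blockSize z p / Real.sqrt b := by positivity
      linarith
    · rw [Set.indicator_of_notMem hω, add_zero]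
      refine (abs_sqrt_sub_sqrt_le (by positivity) hb).trans ?_
      gcongr
      rw [← mul_div_cancel_right₀ b hp'.ne', ← sub_div, abs_div, abs_of_pos hp']
      gcongr
      exact (not_le.1 hω).le
  rw [hG.mu_eq_integral p hp]
  calc |∫ ω, a ω ∂Pr - Real.sqrt b| = |∫ ω, (a ω - Real.sqrt b) ∂Pr| := by
        rw [integral_sub hai (integrable_const _)]
        simp
    _ ≤ ∫ ω, |a ω - Real.sqrt b| ∂Pr := abs_integral_le_integral_abs
    _ ≤ ∫ ω, (t / blockSize z p / Real.sqrt b + T.indicator (fun _ => (1 : ℝ)) ω) ∂Pr := by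
        refine integral_mono (hai.sub (integrable_const _)).abs
          ((integrable_const _).add ((integrable_const _).indicator hTm)) hpt
    _ = t / blockSize z p / Real.sqrt b + Pr.real T := by
        rw [integral_add (integrable_const _) ((integrable_const _).indicator hTm),
          integral_indicator_const _ hTm]
        simp
    _ ≤ _ := by gcongr

end Concentration

/-! ### The good event and its probability -/

/-- The power 12 is 8 + 4: q^8 = n² pays for the union bound over edges, and q^4 = n remains. The
constant is 6!. -/
theorem exp_neg_sq_le {q : ℝ} (hq : 0 < q) : Real.exp (-q ^ 2) ≤ 720 / q ^ 12 := by
  have h := Real.pow_div_factorial_le_exp (q ^ 2) (by positivity) 6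
  rw [Real.exp_neg, inv_le_comm₀ (Real.exp_pos _) (by positivity), inv_div]
  have h6 : ((Nat.factorial 6 : ℕ) : ℝ) = 720 := by norm_num [Nat.factorial]
  rw [h6, ← pow_mul] at h
  exact h

/-- The edge counts of `G` in the stars and in the blocks are close to their means, and there are
no edges in the blocks of probability zero. -/
structure Concentrated (z : Fin n → Fin k) (B : Matrix (Fin k) (Fin k) ℝ) (q : ℝ)
    (G : SimpleGraph (Fin n)) : Prop where
  star_lt : ∀ e p, |∑ f ∈ star z e p, (delta G f - B (blockOf z f).1.1 (blockOf z f).1.2)| < q ^ 3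
  block_lt : ∀ p, |∑ f ∈ edgeBlock z p, (delta G f - B (blockOf z f).1.1 (blockOf z f).1.2)| < q ^ 5
  eq_zero : ∀ e, B (blockOf z e).1.1 (blockOf z e).1.2 = 0 → delta G e = 0

section Probability

variable {Ω : Type*} [MeasurableSpace Ω] {Pr : Measure Ω} [IsProbabilityMeasure Pr]
  {z : Fin n → Fin k} {B : Matrix (Fin k) (Fin k) ℝ} {G : Ω → SimpleGraph (Fin n)}

omit [IsProbabilityMeasure Pr] in
theorem measureReal_iUnion_le_card_mul {ι : Type*} [Fintype ι] {s : ι → Set Ω} {N ε : ℝ}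
    (hN : (Fintype.card ι : ℝ) ≤ N) (hε : 0 ≤ ε) (hs : ∀ i, Pr.real (s i) ≤ ε) :
    Pr.real (⋃ i, s i) ≤ N * ε := by
  calc Pr.real (⋃ i, s i) ≤ ∑ i, Pr.real (s i) := measureReal_iUnion_fintype_le s
    _ ≤ ∑ _i : ι, ε := Finset.sum_le_sum fun i _ => hs i
    _ = Fintype.card ι * ε := by simp
    _ ≤ N * ε := by gcongr

theorem IsSBM.measure_not_concentrated_le (hG : IsSBM Pr z B G) {q : ℝ} (hq : 1 ≤ q)
    (hn : (n : ℝ) = q ^ 4) :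
    Pr.real {ω | ¬ Concentrated z B q (G ω)} ≤ 2880 * (k : ℝ) ^ 2 / n := by
  have hq0 : 0 < q := by linarith
  have hexp := exp_neg_sq_le hq0
  have hcE : (Fintype.card (Edge n) : ℝ) ≤ q ^ 8 := by
    have : (Fintype.card (Edge n) : ℝ) ≤ (n : ℝ) ^ 2 := by exact_mod_cast card_edge_le n
    rw [hn] at this
    linarith
  have hcB : (Fintype.card (Block k) : ℝ) ≤ (k : ℝ) ^ 2 := by exact_mod_cast card_block_le k
  have hcEB : (Fintype.card (Edge n × Block k) : ℝ) ≤ q ^ 8 * (k : ℝ) ^ 2 := by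
    rw [Fintype.card_prod, Nat.cast_mul]
    gcongr
  have hstar : ∀ x : Edge n × Block k, Pr.real {ω | q ^ 3 ≤ |∑ f ∈ star z x.1 x.2,
      (delta (G ω) f - B (blockOf z f).1.1 (blockOf z f).1.2)|} ≤ 2 * Real.exp (-q ^ 2) := by
    intro x
    have hc : ((star z x.1 x.2).card : ℝ) ≤ 2 * q ^ 4 := by
      rw [← hn]
      exact_mod_cast card_star_le z x.1 x.2
    -- With t = q^3 and M = 2q^4 the Hoeffding exponent 2t²/M is exactly q².
    convert hG.measure_sum_delta_ge_le _ hc (pow_pos hq0 3) using 4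
    field_simp
  have hblock : ∀ p : Block k, Pr.real {ω | q ^ 5 ≤ |∑ f ∈ edgeBlock z p,
      (delta (G ω) f - B (blockOf z f).1.1 (blockOf z f).1.2)|} ≤ 2 * Real.exp (-q ^ 2) := by
    intro p
    have hc : ((edgeBlock z p).card : ℝ) ≤ q ^ 8 := by
      have : ((edgeBlock z p).card : ℝ) ≤ (n : ℝ) ^ 2 := by exact_mod_cast blockSize_le z p
      rw [hn] at this
      linarith
    refine (hG.measure_sum_delta_ge_le _ hc (pow_pos hq0 5)).trans ?_
    gcongr
    rw [show 2 * (q ^ 5) ^ 2 / q ^ 8 = 2 * q ^ 2 by field_simp]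
    nlinarith
  have hnull : Pr.real {ω | ¬ ∀ e, B (blockOf z e).1.1 (blockOf z e).1.2 = 0 →
      delta (G ω) e = 0} = 0 := by
    rw [measureReal_eq_zero_iff]
    refine ae_iff.1 (ae_all_iff.2 fun e => ?_)
    by_cases h : B (blockOf z e).1.1 (blockOf z e).1.2 = 0
    · filter_upwards [hG.ae_delta_eq_zero e h] with ω hω _ using hω
    · exact ae_of_all _ fun ω h' => absurd h' h
  calc Pr.real {ω | ¬ Concentrated z B q (G ω)}
      ≤ Pr.real (((⋃ x : Edge n × Block k, {ω | q ^ 3 ≤ |∑ f ∈ star z x.1 x.2,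
          (delta (G ω) f - B (blockOf z f).1.1 (blockOf z f).1.2)|}) ∪
          (⋃ p : Block k, {ω | q ^ 5 ≤ |∑ f ∈ edgeBlock z p,
          (delta (G ω) f - B (blockOf z f).1.1 (blockOf z f).1.2)|})) ∪
          {ω | ¬ ∀ e, B (blockOf z e).1.1 (blockOf z e).1.2 = 0 → delta (G ω) e = 0}) := by
        refine measureReal_mono fun ω hω => ?_
        by_contra hcon
        simp only [Set.mem_union, Set.mem_iUnion, Set.mem_ofPred_eq, not_or, not_exists, not_le,
          not_not] at hcon
        exact hω ⟨fun e p => hcon.1.1 (e, p), hcon.1.2, hcon.2⟩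
    _ ≤ q ^ 8 * (k : ℝ) ^ 2 * (2 * Real.exp (-q ^ 2)) + (k : ℝ) ^ 2 * (2 * Real.exp (-q ^ 2))
          + 0 := by
        refine (measureReal_union_le _ _).trans (add_le_add ((measureReal_union_le _ _).trans
          (add_le_add ?_ ?_)) hnull.le)
        · exact measureReal_iUnion_le_card_mul hcEB (by positivity) hstar
        · exact measureReal_iUnion_le_card_mul hcB (by positivity) hblock
    _ = (q ^ 8 + 1) * ((k : ℝ) ^ 2 * (2 * Real.exp (-q ^ 2))) := by ring
    _ ≤ (q ^ 8 + q ^ 8) * ((k : ℝ) ^ 2 * (2 * (720 / q ^ 12))) := by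
        gcongr
        exact one_le_pow₀ hq
    _ = 2880 * (k : ℝ) ^ 2 / n := by
        rw [hn]
        field_simp
        ring

end Probability

/-! ### Bounds on the good event -/

section Deterministic

variable {z : Fin n → Fin k} {B : Matrix (Fin k) (Fin k) ℝ} {G : SimpleGraph (Fin n)}

/-- The observed density s = m̂/m is within 1/(κq³) ≤ β/2 of b, so s ≥ β/2 and ρ = 1/√s is bounded.
Then bρ and μ are both compared with √b. -/
theorem Concentrated.rescale_bounds {q κ β μ : ℝ} {p : Block k} (hC : Concentrated z B q G)
    (hκ : 0 < κ) (hβ : 0 < β) (hb : β ≤ B p.1.1 p.1.2) (hb1 : B p.1.1 p.1.2 ≤ 1)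
    (hq : 1 ≤ q) (hq2 : 2 / (β * κ) ≤ q) (hm : κ * q ^ 8 ≤ blockSize z p)
    (hμ : |μ - Real.sqrt (B p.1.1 p.1.2)| ≤
      q ^ 5 / blockSize z p / Real.sqrt (B p.1.1 p.1.2) + 1440 / q ^ 12) :
    rescale z G p ≤ Real.sqrt (2 / β) ∧
      |B p.1.1 p.1.2 * rescale z G p - μ| ≤
        ((Real.sqrt (2 / β) + 1) / (κ * Real.sqrt β) + 1440) / q := by
  set b := B p.1.1 p.1.2
  have hq0 : 0 < q := by linarith
  have hm0 : (0 : ℝ) < blockSize z p := lt_of_lt_of_le (by positivity) hm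
  have hb0 : 0 < b := hβ.trans_le hb
  have hdev := hC.block_lt p
  rw [sum_delta_sub_edgeBlock] at hdev
  set m : ℝ := (blockSize z p : ℝ)
  set s : ℝ := (obsSize z G p : ℝ) / m with hs
  have hqm : q ^ 5 / m ≤ 1 / (κ * q ^ 3) := by
    rw [div_le_div_iff₀ hm0 (by positivity)]
    calc q ^ 5 * (κ * q ^ 3) = κ * q ^ 8 := by ring
      _ ≤ 1 * m := by rw [one_mul]; exact hm
  have hsb : |s - b| ≤ q ^ 5 / m := by
    rw [hs, show (obsSize z G p : ℝ) / m - b = ((obsSize z G p : ℝ) - b * m) / m by field_simp,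
      abs_div, abs_of_pos hm0]
    gcongr
  have hq3 : 1 / (κ * q ^ 3) ≤ β / 2 := by
    rw [div_le_iff₀ (by positivity)] at hq2
    rw [div_le_div_iff₀ (by positivity) two_pos]
    have : q ≤ q ^ 3 := le_self_pow₀ hq (by norm_num)
    calc 1 * 2 ≤ q * (β * κ) := by linarith
      _ ≤ q ^ 3 * (β * κ) := by gcongr
      _ = β * (κ * q ^ 3) := by ring
  have hs2 : β / 2 ≤ s := by linarith [(abs_le.1 (hsb.trans (hqm.trans hq3))).1]
  have hs0 : 0 < s := by linarith
  have hobs : obsSize z G p ≠ 0 := by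
    intro h
    simp [hs, h] at hs0
  have hρ : rescale z G p = (Real.sqrt s)⁻¹ := by
    rw [rescale, if_neg hobs, ← Real.sqrt_inv, hs, inv_div]
  have hR : (Real.sqrt s)⁻¹ ≤ Real.sqrt (2 / β) := by
    rw [← Real.sqrt_inv]
    refine Real.sqrt_le_sqrt ?_
    rw [inv_le_comm₀ hs0 (by positivity), inv_div]
    exact hs2
  rw [hρ]
  refine ⟨hR, ?_⟩
  have ha := Real.sqrt_pos.2 hs0
  have hsb0 := Real.sqrt_pos.2 hb0
  have hsβ : Real.sqrt β ≤ Real.sqrt b := Real.sqrt_le_sqrt hb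
  have hsβ0 := Real.sqrt_pos.2 hβ
  have hsb1 : Real.sqrt b ≤ 1 := Real.sqrt_le_one.2 hb1
  have hdev' : q ^ 5 / m / Real.sqrt b ≤ 1 / (κ * Real.sqrt β) / q := by
    calc q ^ 5 / m / Real.sqrt b ≤ 1 / (κ * q ^ 3) / Real.sqrt β := by gcongr
      _ = 1 / (κ * Real.sqrt β) / q ^ 3 := by field_simp
      _ ≤ _ := by
        gcongr
        exact le_self_pow₀ hq (by norm_num)
  have h1 : |b * (Real.sqrt s)⁻¹ - Real.sqrt b| ≤
      Real.sqrt (2 / β) * (1 / (κ * Real.sqrt β) / q) := by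
    have heq : b * (Real.sqrt s)⁻¹ - Real.sqrt b =
        (Real.sqrt s)⁻¹ * (Real.sqrt b * -(Real.sqrt s - Real.sqrt b)) := by
      have := Real.mul_self_sqrt hb0.le
      field_simp
      linear_combination (-this)
    rw [heq, abs_mul, abs_mul, abs_neg, abs_of_pos hsb0, abs_of_pos (inv_pos.2 ha)]
    refine mul_le_mul hR ?_ (by positivity) (by positivity)
    refine (mul_le_of_le_one_left (abs_nonneg _) hsb1).trans ?_
    refine (abs_sqrt_sub_sqrt_le hs0.le hb0).trans (le_trans ?_ hdev')
    gcongr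
  -- The powers q^(-3) and q^(-12) are weakened to 1/q: multiplied by the 2q^4 edges of a star, this
  -- still gives q^3.
  have h2 : (1440 : ℝ) / q ^ 12 ≤ 1440 / q := by
    gcongr
    exact le_self_pow₀ hq (by norm_num)
  calc |b * (Real.sqrt s)⁻¹ - μ| ≤ |b * (Real.sqrt s)⁻¹ - Real.sqrt b| + |Real.sqrt b - μ| :=
        abs_sub_le _ _ _
    _ ≤ Real.sqrt (2 / β) * (1 / (κ * Real.sqrt β) / q) +
        (1 / (κ * Real.sqrt β) / q + 1440 / q) := by
        rw [abs_sub_comm (Real.sqrt b)]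
        gcongr
        linarith
    _ = _ := by ring

theorem Concentrated.abs_sum_star_le {q κ β μ : ℝ} {p : Block k} (hC : Concentrated z B q G)
    (hκ : 0 < κ) (hβ : 0 < β) (hb : β ≤ B p.1.1 p.1.2) (hb1 : B p.1.1 p.1.2 ≤ 1)
    (hq : 1 ≤ q) (hn : (n : ℝ) = q ^ 4) (hq2 : 2 / (β * κ) ≤ q)
    (hm : κ * q ^ 8 ≤ blockSize z p)
    (hμ : |μ - Real.sqrt (B p.1.1 p.1.2)| ≤
      q ^ 5 / blockSize z p / Real.sqrt (B p.1.1 p.1.2) + 1440 / q ^ 12) (e : Edge n) :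
    |∑ f ∈ star z e p, (Y z G f - μ)| ≤
      (Real.sqrt (2 / β) + 2 * ((Real.sqrt (2 / β) + 1) / (κ * Real.sqrt β) + 1440)) * q ^ 3 := by
  classical
  obtain ⟨h1, h2⟩ := hC.rescale_bounds hκ hβ hb hb1 hq hq2 hm hμ
  have hq0 : 0 < q := by linarith
  have hρ := rescale_nonneg z G p
  have hcard : ((star z e p).card : ℝ) ≤ 2 * q ^ 4 := by
    rw [← hn]
    exact_mod_cast card_star_le z e p
  have hsum : ∑ f ∈ star z e p, (Y z G f - μ) =
      rescale z G p * ∑ f ∈ star z e p, (delta G f - B (blockOf z f).1.1 (blockOf z f).1.2) +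
        (star z e p).card * (B p.1.1 p.1.2 * rescale z G p - μ) := by
    rw [Finset.mul_sum, ← nsmul_eq_mul, ← Finset.sum_const, ← Finset.sum_add_distrib]
    refine Finset.sum_congr rfl fun f hf => ?_
    rw [Y, mem_edgeBlock.1 (Finset.mem_filter.1 hf).1]
    ring
  rw [hsum]
  refine (abs_add_le _ _).trans ?_
  rw [abs_mul, abs_mul, abs_of_nonneg hρ, Nat.abs_cast]
  set D := (Real.sqrt (2 / β) + 1) / (κ * Real.sqrt β) + 1440 with hD
  have hD0 : 0 ≤ D := by positivity
  calc _ ≤ Real.sqrt (2 / β) * q ^ 3 + 2 * q ^ 4 * (D / q) :=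
        add_le_add (mul_le_mul h1 (hC.star_lt e p).le (abs_nonneg _) (Real.sqrt_nonneg _))
          (mul_le_mul hcard h2 (abs_nonneg _) (by positivity))
    _ = _ := by field_simp

end Deterministic

/-! ### From entries to the Frobenius norm -/

/-- The squared Frobenius norm is at most the number of entries times the maximal square. -/
theorem frobenius_norm_le {ι κ : Type*} [Fintype ι] [Fintype κ] (A : Matrix ι κ ℝ) {N x : ℝ}
    (hN : (Fintype.card ι : ℝ) * Fintype.card κ ≤ N ^ 2) (hN0 : 0 ≤ N) (hx : 0 ≤ x)
    (hA : ∀ i j, |A i j| ≤ x) : ‖A‖ ≤ N * x := by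
  rw [Matrix.frobenius_norm_def, ← Real.sqrt_eq_rpow]
  refine Real.sqrt_le_iff.2 ⟨by positivity, ?_⟩
  calc ∑ i, ∑ j, ‖A i j‖ ^ (2 : ℝ) ≤ ∑ _i : ι, ∑ _j : κ, x ^ 2 := by
        refine Finset.sum_le_sum fun i _ => Finset.sum_le_sum fun j _ => ?_
        rw [Real.rpow_two, Real.norm_eq_abs]
        gcongr
        exact hA i j
    _ = (Fintype.card ι : ℝ) * Fintype.card κ * x ^ 2 := by
        simp
        ring
    _ ≤ (N * x) ^ 2 := by rw [mul_pow]; gcongr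

theorem IsSBM.norm_H_le {Ω : Type*} [MeasurableSpace Ω] {Pr : Measure Ω} [IsProbabilityMeasure Pr]
    {z : Fin n → Fin k} {B : Matrix (Fin k) (Fin k) ℝ} {G : Ω → SimpleGraph (Fin n)}
    (hG : IsSBM Pr z B G) (hB : ∀ r s, B r s ∈ Set.Icc (0 : ℝ) 1) {q κ β : ℝ} (hκ : 0 < κ)
    (hβ : 0 < β) (hBβ : ∀ r s, B r s = 0 ∨ β ≤ B r s) (hq : 1 ≤ q) (hn : (n : ℝ) = q ^ 4)
    (hq2 : 2 / (β * κ) ≤ q) (hm : ∀ p, κ * q ^ 8 ≤ blockSize z p) {ω : Ω}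
    (hC : Concentrated z B q (G ω)) :
    ‖H Pr z G ω‖ ≤ k * ((Real.sqrt (2 / β) +
      2 * ((Real.sqrt (2 / β) + 1) / (κ * Real.sqrt β) + 1440)) / Real.sqrt κ) * q ^ 3 := by
  classical
  have hq0 : 0 < q := by linarith
  set D := Real.sqrt (2 / β) + 2 * ((Real.sqrt (2 / β) + 1) / (κ * Real.sqrt β) + 1440) with hD
  have hD0 : 0 ≤ D := by positivity
  have hκ' := Real.sqrt_pos.2 hκ
  have hsum : ∀ e p, |∑ f ∈ star z e p, (Y z (G ω) f - mu Pr z G p)| ≤ D * q ^ 3 := by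
    intro e p
    -- If b = 0, both μ and every Y_f of the block vanish on the good event.
    rcases hBβ p.1.1 p.1.2 with h0 | hb
    · rw [Finset.sum_eq_zero, abs_zero]
      · positivity
      · intro f hf
        have hf' := mem_edgeBlock.1 (Finset.mem_filter.1 hf).1
        rw [hG.mu_eq_zero p h0, Y, hC.eq_zero f (by rw [hf', h0])]
        ring
    · refine hC.abs_sum_star_le hκ hβ hb (hB _ _).2 hq hn hq2 (hm p) ?_ e
      have hm0 : 0 < blockSize z p := by
        have : (0 : ℝ) < blockSize z p := lt_of_lt_of_le (by positivity) (hm p)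
        exact_mod_cast this
      refine (hG.abs_mu_sub_sqrt_le hB p hm0 (hβ.trans_le hb) (pow_pos hq0 5)).trans ?_
      gcongr
      have h1 := exp_neg_sq_le hq0
      have h2 : Real.exp (-(2 * (q ^ 5) ^ 2 / (n : ℝ) ^ 2)) ≤ Real.exp (-q ^ 2) := by
        rw [hn, show 2 * (q ^ 5) ^ 2 / (q ^ 4) ^ 2 = 2 * q ^ 2 by field_simp]
        exact Real.exp_le_exp.2 (by nlinarith)
      calc _ ≤ 2 * (720 / q ^ 12) := by linarith
        _ = _ := by ring
  have hentry : ∀ e p, |H Pr z G ω e p| ≤ D * q ^ 3 * (Real.sqrt κ * q ^ 4)⁻¹ := by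
    intro e p
    rw [H_apply, lineAdj_sum, abs_mul]
    refine mul_le_mul (hsum e p) ?_ (abs_nonneg _) (by positivity)
    rw [abs_of_nonneg (by positivity)]
    refine inv_anti₀ (by positivity) ?_
    rw [← Real.sqrt_sq (by positivity : 0 ≤ q ^ 4), ← Real.sqrt_mul hκ.le]
    refine Real.sqrt_le_sqrt ((le_of_eq ?_).trans (hm p))
    ring
  refine (frobenius_norm_le _ (N := q ^ 4 * k) ?_ (by positivity) (by positivity)
    hentry).trans_eq ?_
  · rw [mul_pow, ← hn]
    refine mul_le_mul ?_ ?_ (by positivity) (by positivity)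
    · exact_mod_cast card_edge_le n
    · exact_mod_cast card_block_le k
  · field_simp

/-- Finitely many conditions, each valid for all small β > 0, hold together. -/
theorem exists_pos_forall_eq_zero_or_le (B : Matrix (Fin k) (Fin k) ℝ)
    (hB : ∀ r s, 0 ≤ B r s) : ∃ β : ℝ, 0 < β ∧ ∀ r s, B r s = 0 ∨ β ≤ B r s := by
  have h : ∀ᶠ β in nhdsWithin (0 : ℝ) (Set.Ioi 0), ∀ r s, B r s = 0 ∨ β ≤ B r s := by
    refine Filter.eventually_all.2 fun r => Filter.eventually_all.2 fun s => ?_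
    rcases (hB r s).eq_or_lt with h0 | hpos
    · exact Filter.Eventually.of_forall fun _ => Or.inl h0.symm
    · filter_upwards [Ioo_mem_nhdsGT hpos] with β hβ using Or.inr hβ.2.le
  obtain ⟨β, hβ, hβ0⟩ := (h.and self_mem_nhdsWithin).exists
  exact ⟨β, hβ0, hβ⟩

end SBMLineGraph

end

theorem proposition4 {k : ℕ} (B : Matrix (Fin k) (Fin k) ℝ) (hB : B.IsSymm)
    (hB01 : ∀ r s, B r s ∈ Set.Icc (0 : ℝ) 1) :
    (∀ (n : ℕ) (z : Fin n → Fin k), (∀ r, 2 ≤ SBMLineGraph.clusterSize z r) →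
      ∀ (Ω : Type u) [MeasurableSpace Ω] (Pr : Measure Ω) [IsProbabilityMeasure Pr]
        (G : Ω → SimpleGraph (Fin n)), SBMLineGraph.IsSBM Pr z B G →
        (∀ e, SBMLineGraph.muEdge Pr z G e = SBMLineGraph.mu Pr z G (SBMLineGraph.blockOf z e)) ∧
        iIndepFun (fun (p : SBMLineGraph.Block k) (ω : Ω) (e : SBMLineGraph.Edge n) =>
          SBMLineGraph.H Pr z G ω e p) Pr) ∧
    (∀ c : ℝ, 0 < c → ∃ (C K : ℝ) (N : ℕ), ∀ n : ℕ, N ≤ n →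
      ∀ z : Fin n → Fin k, (∀ r, 2 ≤ SBMLineGraph.clusterSize z r) →
      (∀ r, c * (n : ℝ) ≤ (SBMLineGraph.clusterSize z r : ℝ)) →
      ∀ (Ω : Type u) [MeasurableSpace Ω] (Pr : Measure Ω) [IsProbabilityMeasure Pr]
        (G : Ω → SimpleGraph (Fin n)), SBMLineGraph.IsSBM Pr z B G →
        1 - K / (n : ℝ) ≤
          Pr.real {ω | ‖SBMLineGraph.H Pr z G ω‖ ≤ C * (n : ℝ) ^ (3 / 4 : ℝ)}) := by
  refine ⟨fun n z _ Ω _ Pr _ G hG => ⟨hG.muEdge_eq_mu, hG.iIndepFun_columns⟩, fun c hc => ?_⟩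
  obtain ⟨β, hβ, hBβ⟩ :=
    SBMLineGraph.exists_pos_forall_eq_zero_or_le B fun r s => (hB01 r s).1
  have hκ : 0 < c ^ 2 / 4 := by positivity
  set κ := c ^ 2 / 4 with hκdef
  -- The ceiling gives n ≥ (2/(βκ))^4, that is q ≥ 2/(βκ); the extra 1 gives n ≥ 1 and hence q ≥ 1.
  refine ⟨k * ((Real.sqrt (2 / β) +
      2 * ((Real.sqrt (2 / β) + 1) / (κ * Real.sqrt β) + 1440)) / Real.sqrt κ),
    2880 * (k : ℝ) ^ 2, ⌈(2 / (β * κ)) ^ 4⌉₊ + 1, fun n hn z hz hzc Ω _ Pr _ G hG => ?_⟩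
  set q : ℝ := (n : ℝ) ^ (1 / 4 : ℝ) with hqdef
  have hn1 : (1 : ℝ) ≤ n := by exact_mod_cast (by omega : 1 ≤ n)
  have hq : 1 ≤ q := Real.one_le_rpow hn1 (by norm_num)
  have hq4 : (n : ℝ) = q ^ 4 := by
    rw [hqdef, ← Real.rpow_natCast, ← Real.rpow_mul (by positivity)]
    norm_num
  have hq3 : (n : ℝ) ^ (3 / 4 : ℝ) = q ^ 3 := by
    rw [hqdef, ← Real.rpow_natCast, ← Real.rpow_mul (by positivity)]
    norm_num
  have hq2 : 2 / (β * κ) ≤ q := by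
    refine le_of_pow_le_pow_left₀ (n := 4) (by norm_num) (by positivity) ?_
    rw [← hq4]
    exact (Nat.le_ceil _).trans (by exact_mod_cast (Nat.le_succ _).trans hn)
  have hm : ∀ p, κ * q ^ 8 ≤ SBMLineGraph.blockSize z p := fun p => by
    have := SBMLineGraph.le_blockSize hc z hz hzc p
    rwa [hq4, ← pow_mul] at this
  have hbad := hG.measure_not_concentrated_le hq hq4
  set good : Set Ω := {ω | SBMLineGraph.Concentrated z B q (G ω)}
  -- Subadditivity suffices, so neither the good event nor the norm event has to be shown
  -- measurable.
  have hgood : 1 ≤ Pr.real good + Pr.real goodᶜ := by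
    rw [← probReal_univ (μ := Pr), ← Set.union_compl_self good]
    exact measureReal_union_le _ _
  have hle : Pr.real good ≤ Pr.real {ω | ‖SBMLineGraph.H Pr z G ω‖ ≤ k * ((Real.sqrt (2 / β) +
      2 * ((Real.sqrt (2 / β) + 1) / (κ * Real.sqrt β) + 1440)) / Real.sqrt κ) *
        (n : ℝ) ^ (3 / 4 : ℝ)} := by
    refine measureReal_mono fun ω hω => ?_
    rw [Set.mem_ofPred, hq3]
    exact hG.norm_H_le hB01 hκ hβ hBβ hq hq4 hq2 hm hω
  have hbad' : Pr.real goodᶜ ≤ 2880 * (k : ℝ) ^ 2 / n := hbad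
  linarith
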